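/- Let $\mathfrak X$ be a countable set and let $\Omega=\{0,1\}^{\mathfrak X}$ carry its Borel $\sigma$-algebra; a configuration $\omega\in\Omega$ is identified with a subset of $\mathfrak X$. Let $\mathcal K=\ell^2(\mathfrak X)\oplus\ell^2(\mathfrak X)$ (complex Hilbert spaces, inner product linear in the second argument), let $(e_x)_{x\in\mathfrak X}$ be the standard basis of $\ell^2(\mathfrak X)$, let $J$ be the coordinatewise complex conjugation on $\ell^2(\mathfrak X)$, and set $\Gamma(u,v)=(Jv,Ju)$. Let $\mathrm{Gr}(\mathcal K,\Gamma)$ be the set of bounded operators $P$ on $\mathcal K$ with $P=P^*=P^2$ (so $0\le P\le 1$) and $\Gamma P\Gamma=1-P$. For $P=\begin{pmatrix}P_{11}&P_{12}\\P_{21}&P_{22}\end{pmatrix}\in\mathrm{Gr}(\mathcal K,\Gamma)$ put $$\mathbb K_P(x,y)=\begin{pmatrix}(e_x,P_{21}e_y)&(e_x,P_{22}e_y)\\(e_x,(P_{11}-1)e_y)&(e_x,P_{12}e_y)\end{pmatrix},\qquad x,y\in\mathfrak X.$$ Let $M^P$ denote the Pfaffian point process associated with $P$, i.e. the (existing and unique)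 probability measure on $\Omega$ whose correlation functions are $$\rho_n(x_1,\dots,x_n)=\operatorname{Pf}\big[\mathbb K_P(x_i,x_j)\big]_{1\le i,j\le n},\qquad n\in\mathbb N,\ x_1,\dots,x_n\in\mathfrak X,$$ where $\rho_n(x_1,\dots,x_n)=M^P(\{\omega:x_1,\dots,x_n\in\omega\})$ if $x_1,\dots,x_n$ are distinct and $\rho_n(x_1,\dots,x_n)=0$ otherwise; the kernel satisfies $\mathbb K_P(x,y)^{\mathrm T}=-\mathbb K_P(y,x)$, and $[\mathbb K_P(x_i,x_j)]$ is read as the $2n\times 2n$ matrix with $2\times2$ blocks $\mathbb K_P(x_i,x_j)$. Let $X\subset\mathfrak X$ and let $P_X^{\mathrm{fin}}$ be the orthogonal projection of $\mathcal K$ onto $\mathcal K^+_{\mathfrak X\setminus X}\oplus\mathcal K^-_X$, where $\mathcal K^+_A=\overline{\operatorname{Span}}\{(e_x,0):x\in A\}$ and $\mathcal K^-_A=\overline{\operatorname{Span}}\{(0,e_x):x\in A\}$. If $P\in\mathrm{Gr}(\mathcal K,\Gamma)$ and $P-P_X^{\mathrm{fin}}$ is a Hilbert–Schmidt operator, then $M^P$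 (exists, is unique, and) is supported on $$\Omega_X^{\mathrm{fin}}=\{\omega\in\Omega:\ \omega\setminus X\text{ and }X\setminus\omega\text{ are both finite}\},\qquad\text{i.e. } M^P(\Omega\setminus\Omega_X^{\mathrm{fin}})=0.$$ -/

import Mathlib

open MeasureTheory

noncomputable section

namespace PfPP

/-- Point configurations `ω : 𝔛 → {0,1}`, with the product topology and the product
`σ`-algebra (the Borel one, since `𝔛` is countable; see `borelSpace_config`). -/
abbrev Config (𝔛 : Type*) : Type _ := 𝔛 → Bool

theorem borelSpace_config (𝔛 : Type*) [Countable 𝔛] : BorelSpace (Config 𝔛) := inferInstance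

/-- The set of occupied points of a configuration. -/
def occupied {𝔛 : Type*} (ω : Config 𝔛) : Set 𝔛 := {x | ω x = true}

/-- The cylinder set of configurations occupying all the points `x₁, …, xₙ`. -/
def cylinder {𝔛 : Type*} {n : ℕ} (x : Fin n → 𝔛) : Set (Config 𝔛) :=
  {ω | ∀ i, ω (x i) = true}

open Classical in
/-- The `n`-point correlation function, extended by zero to tuples with a repeated point. -/
def correlation {𝔛 : Type*} (M : Measure (Config 𝔛)) {n : ℕ} (x : Fin n → 𝔛) : ℝ :=
  if Function.Injective x then M.real (cylinder x) else 0

/-- The Pfaffian of a `2n × 2n` matrix, `n = |ι|`, whose rows and columns come in pairs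
`(k, 0), (k, 1)`:
`Pf A = (1 / (2ⁿ n!)) ∑_σ sgn σ ∏ₖ A (σ (k, 0)) (σ (k, 1))`. The position `2 (k - 1) + i`
of the usual enumeration by `1, …, 2n` is the index `(k, i)` here. -/
def pfaffian {ι : Type*} [Fintype ι] [DecidableEq ι]
    (A : Matrix (ι × Fin 2) (ι × Fin 2) ℂ) : ℂ :=
  ((2 : ℂ) ^ Fintype.card ι * (Nat.factorial (Fintype.card ι) : ℂ))⁻¹ *
    ∑ σ : Equiv.Perm (ι × Fin 2),
      ((Equiv.Perm.sign σ : ℤ) : ℂ) * ∏ k : ι, A (σ (k, 0)) (σ (k, 1))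

/-- The `2n × 2n` matrix `[K(xᵢ, xⱼ)]`. -/
def kernelMatrix {𝔛 : Type*} (K : 𝔛 → 𝔛 → Matrix (Fin 2) (Fin 2) ℂ) {n : ℕ} (x : Fin n → 𝔛) :
    Matrix (Fin n × Fin 2) (Fin n × Fin 2) ℂ :=
  Matrix.of fun p q => K (x p.1) (x q.1) p.2 q.2

/-- `M` is a Pfaffian point process with correlation kernel `K`. -/
structure IsPfaffianProcess {𝔛 : Type*} (K : 𝔛 → 𝔛 → Matrix (Fin 2) (Fin 2) ℂ)
    (M : Measure (Config 𝔛)) : Prop where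
  isProbabilityMeasure : IsProbabilityMeasure M
  antisymm : ∀ x y, (K x y).transpose = -K y x
  correlation_eq : ∀ (n : ℕ) (x : Fin n → 𝔛),
    ((correlation M x : ℝ) : ℂ) = pfaffian (kernelMatrix K x)

/-- `ℓ²(𝔛)`. -/
abbrev Ell2 (𝔛 : Type*) : Type _ := lp (fun _ : 𝔛 => ℂ) 2

/-- The doubled space `ℓ²(𝔛) ⊕ ℓ²(𝔛)` (Hilbert space direct sum). -/
abbrev Doubled (𝔛 : Type*) : Type _ := WithLp 2 (Ell2 𝔛 × Ell2 𝔛)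

open Classical in
/-- The standard basis vector `e_x` of `ℓ²(𝔛)`. -/
def e {𝔛 : Type*} (x : 𝔛) : Ell2 𝔛 := lp.single 2 x (1 : ℂ)

/-- The vector `(u, v)` of the doubled space. -/
def pair {𝔛 : Type*} (u v : Ell2 𝔛) : Doubled 𝔛 := WithLp.toLp 2 (u, v)

/-- The complex conjugation of `ℓ²(𝔛)`, which is pointwise and so fixes every `e_x`. -/
def J {𝔛 : Type*} (u : Ell2 𝔛) : Ell2 𝔛 := star u

/-- The anti-unitary involution `Γ (u, v) = (J v, J u)`. -/
def Γ {𝔛 : Type*} (f : Doubled 𝔛) : Doubled 𝔛 := pair (J f.snd) (J f.fst)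

/-- The operators `0 ≤ S = S* ≤ 1` with `Γ S Γ = 1 - S`. -/
structure IsCovariance {𝔛 : Type*} (S : Doubled 𝔛 →L[ℂ] Doubled 𝔛) : Prop where
  isSelfAdjoint : IsSelfAdjoint S
  nonneg : 0 ≤ S
  le_one : S ≤ 1
  conj_eq : ∀ f, Γ (S (Γ f)) = ((1 : Doubled 𝔛 →L[ℂ] Doubled 𝔛) - S) f

/-- The Grassmannian: the projections among the covariance operators. -/
def Gr (𝔛 : Type*) : Set (Doubled 𝔛 →L[ℂ] Doubled 𝔛) :=
  {P | IsCovariance P ∧ P * P = P}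

/-- The matrix kernel of an operator `S = (S₁₁, S₁₂; S₂₁, S₂₂)`:
`((e_x, S₂₁ e_y), (e_x, S₂₂ e_y); (e_x, (S₁₁ - 1) e_y), (e_x, S₁₂ e_y))`. -/
def kernel {𝔛 : Type*} (S : Doubled 𝔛 →L[ℂ] Doubled 𝔛) (x y : 𝔛) : Matrix (Fin 2) (Fin 2) ℂ :=
  !![inner ℂ (e x) (S (pair (e y) 0)).snd, inner ℂ (e x) (S (pair 0 (e y))).snd;
     inner ℂ (e x) ((S (pair (e y) 0)).fst - e y), inner ℂ (e x) (S (pair 0 (e y))).fst]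

/-- The closed span of the vectors `(e_x, 0)`, `x ∈ A`. -/
def Kplus {𝔛 : Type*} (A : Set 𝔛) : Submodule ℂ (Doubled 𝔛) :=
  (Submodule.span ℂ ((fun x => pair (e x) 0) '' A)).topologicalClosure

/-- The closed span of the vectors `(0, e_x)`, `x ∈ A`. -/
def Kminus {𝔛 : Type*} (A : Set 𝔛) : Submodule ℂ (Doubled 𝔛) :=
  (Submodule.span ℂ ((fun x => pair 0 (e x)) '' A)).topologicalClosure

/-- The orthogonal projection onto `K⁺_{𝔛 ∖ X} ⊕ K⁻_X`. The closure only serves to make the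
completeness of this (already closed) subspace visible. -/
def Pfin {𝔛 : Type*} (X : Set 𝔛) : Doubled 𝔛 →L[ℂ] Doubled 𝔛 :=
  (Kplus Xᶜ ⊔ Kminus X).topologicalClosure.starProjection

/-- Hilbert–Schmidt operators: `∑ᵢ ‖T bᵢ‖² < ∞` for an orthonormal basis `b` (the sum does not
depend on it). -/
def IsHilbertSchmidt {H : Type*} [NormedAddCommGroup H] [InnerProductSpace ℂ H]
    (T : H →L[ℂ] H) : Prop :=
  ∃ (w : Set H) (b : HilbertBasis w ℂ H), Summable fun i => ‖T (b i)‖ ^ 2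

/-- The configurations `ω` such that `ω ∖ X` and `X ∖ ω` are finite. -/
def OmegaFin {𝔛 : Type*} (X : Set 𝔛) : Set (Config 𝔛) :=
  {ω | (occupied ω \ X).Finite ∧ (X \ occupied ω).Finite}

end PfPP

end

/-! Support: write `f` for `(0, e_x)`. The density at `x` is `(f, P f) = ‖P f‖²`, and `Pfin X` maps
`f` to itself if `x ∈ X` and to `0` otherwise. Since `1 - ‖P f‖² = ‖P f - f‖²`, the probability that
`ω` and `X` disagree at `x` is in both cases `‖(P - Pfin X) f‖²`. The Hilbert–Schmidt condition
makes these probabilities summable, and the first Borel–Cantelli lemma leaves almost surely finitely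
many disagreements (`measure_compl_omegaFin`).

Existence: over a finite window the vectors `P f_p`, with `f_p` the basis vectors, span a
finite-dimensional space, which serves as one-particle space of a finite Fock space. Suitable fields
`β_p` have vacuum two-point function `(Γ f_p, P f_q)` because `P` is a projection, and satisfy the
canonical anticommutation relations because `Γ P Γ = 1 - P`. So the operators `β (x, 0) * β (x, 1)`
are commuting projections, and Wick's theorem evaluates the vacuum expectation of their products as
the required Pfaffian (`exists_numberOperators`). Commuting projections make all inclusion–exclusion
weights nonnegative, so finite-window measures exist; compactness of the configuration space yields
a global one (`exists_measure_of_sieve_nonneg`).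

Uniqueness: the events "all of `S` is occupied", `S` finite, form a π-system generating the
`σ`-algebra. -/

namespace PfPP

/-! ### Wick's rule, stated algebraically. -/

section Wick

variable {V R : Type*} [Ring R]

/-- The ordered product of the fields listed in `l`. -/
def fieldProd (b : V → R) (l : List V) : R := (l.map b).prod

@[simp] theorem fieldProd_nil (b : V → R) : fieldProd b [] = 1 := rfl

@[simp] theorem fieldProd_cons (b : V → R) (p : V) (l : List V) :
    fieldProd b (p :: l) = b p * fieldProd b l := by simp [fieldProd]

@[simp] theorem fieldProd_append (b : V → R) (l l' : List V) :
    fieldProd b (l ++ l') = fieldProd b l * fieldProd b l' := by simp [fieldProd]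

variable [Algebra ℂ R]

/-- A functional `φ` and fields `b p = a p + c p` obeying Wick's rule with contraction `g`. -/
structure IsWick (φ : R →ₗ[ℂ] ℂ) (a c : V → R) (g : V → V → ℂ) : Prop where
  map_one : φ 1 = 1
  map_annihilator : ∀ p x, φ (x * a p) = 0
  map_creator : ∀ p x, φ (c p * x) = 0
  anticomm : ∀ p q, a p * (a q + c q) + (a q + c q) * a p = algebraMap ℂ R (g p q)

/-- Carry `x` through the product to its right end: passing each field costs a sign and leaves a
scalar in place of that field. -/
theorem mul_fieldProd_of_anticomm {b : V → R} {x : R} {γ : V → ℂ}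
    (h : ∀ q, x * b q + b q * x = algebraMap ℂ R (γ q)) (l : List V) :
    x * fieldProd b l = ∑ j : Fin l.length, ((-1) ^ (j : ℕ) * γ l[j]) • fieldProd b (l.eraseIdx j)
      + (-1 : ℂ) ^ l.length • (fieldProd b l * x) := by
  induction l with
  | nil => simp
  | cons q l ih =>
    have h1 : x * b q = γ q • (1 : R) - b q * x := by
      rw [← Algebra.algebraMap_eq_smul_one, ← h q]; abel
    rw [fieldProd_cons, ← mul_assoc, h1, sub_mul, mul_assoc, ih]
    simp only [List.length_cons, Fin.sum_univ_succ]
    simp only [mul_add, Finset.mul_sum, smul_mul_assoc, one_mul, mul_smul_comm]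
    simp [pow_succ, mul_assoc, sub_eq_add_neg]
    abel

/-- The creator part of the first field vanishes at the left end; the annihilator part is carried to
the right end, where it vanishes too, and only the contractions picked up on the way survive. -/
theorem IsWick.map_cons {φ : R →ₗ[ℂ] ℂ} {a c : V → R} {g : V → V → ℂ} (h : IsWick φ a c g)
    (p : V) (l : List V) :
    φ (fieldProd (a + c) (p :: l)) =
      ∑ j : Fin l.length, (-1) ^ (j : ℕ) * g p l[j] * φ (fieldProd (a + c) (l.eraseIdx j)) := by
  rw [fieldProd_cons, Pi.add_apply, add_mul, map_add, h.map_creator, add_zero,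
    mul_fieldProd_of_anticomm (b := a + c) (γ := g p) (fun q => h.anticomm p q)]
  simp [h.map_annihilator]

/-- The recursion `IsWick.map_cons` evaluates `g p q` only for `p` preceding `q` in the list. This
later allows fields to be replaced by others with a different contraction in the opposite order. -/
theorem IsWick.congr {R' : Type*} [Ring R'] [Algebra ℂ R'] {φ : R →ₗ[ℂ] ℂ} {a c : V → R}
    {g : V → V → ℂ} (h : IsWick φ a c g) {φ' : R' →ₗ[ℂ] ℂ} {a' c' : V → R'} {g' : V → V → ℂ}
    (h' : IsWick φ' a' c' g') (l : List V) (hl : l.Pairwise fun p q => g p q = g' p q) :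
    φ (fieldProd (a + c) l) = φ' (fieldProd (a' + c') l) := by
  induction hn : l.length using Nat.strong_induction_on generalizing l with
  | _ n ih =>
    cases l with
    | nil => simp [h.map_one, h'.map_one]
    | cons p l =>
      rw [h.map_cons, h'.map_cons]
      rw [List.pairwise_cons] at hl
      refine Finset.sum_congr rfl fun j _ => ?_
      rw [show g p l[j] = g' p l[j] from hl.1 _ (List.getElem_mem _),
        ih _ (by rw [← hn, List.length_cons, List.length_eraseIdx_of_lt j.2]; omega) _
          (hl.2.sublist (List.eraseIdx_sublist _ _)) rfl]

end Wick

/-! ### Reordering products of anticommuting fields. -/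

section Anticommuting

variable {V R : Type*} [Ring R] [Algebra ℂ R] {b : V → R}

theorem mul_fieldProd_anticomm (hb : ∀ p q, b p * b q = - (b q * b p)) (p : V) (l : List V) :
    b p * fieldProd b l = (-1 : ℂ) ^ l.length • (fieldProd b l * b p) := by
  have := mul_fieldProd_of_anticomm (b := b) (x := b p) (γ := 0) (fun q => by simp [hb p q]) l
  simpa using this

/-- Moving `p` or `q` across `l₂` costs the same sign, so the only net sign comes from exchanging
`p` with `q`. -/
theorem fieldProd_swap (hb : ∀ p q, b p * b q = - (b q * b p)) (p q : V) (l₁ l₂ l₃ : List V) :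
    fieldProd b (l₁ ++ p :: (l₂ ++ q :: l₃)) = - fieldProd b (l₁ ++ q :: (l₂ ++ p :: l₃)) := by
  have h : b p * (fieldProd b l₂ * b q) = - (b q * (fieldProd b l₂ * b p)) := by
    rw [← mul_assoc, ← mul_assoc, mul_fieldProd_anticomm hb p, mul_fieldProd_anticomm hb q,
      smul_mul_assoc, smul_mul_assoc, mul_assoc, mul_assoc, hb p q]
    simp
  simp only [fieldProd_append, fieldProd_cons]
  have := congrArg (fun z => fieldProd b l₁ * (z * fieldProd b l₃)) h
  simpa [mul_assoc] using this

theorem fieldProd_map_perm [Fintype V] [DecidableEq V] (hb : ∀ p q, b p * b q = - (b q * b p))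
    {l : List V} (hl : l.Nodup) (hm : ∀ p, p ∈ l) (σ : Equiv.Perm V) :
    fieldProd b (l.map σ) = ((Equiv.Perm.sign σ : ℤ) : ℂ) • fieldProd b l := by
  induction σ using Equiv.Perm.swap_induction_on with
  | one => simp
  | swap_mul f x y hxy ih =>
    have key : ∀ (l : List V) (x y : V), x ≠ y → l.Nodup → (∃ l₁ l₂ l₃, l = l₁ ++ x :: (l₂ ++ y :: l₃)) →
        fieldProd b (l.map (Equiv.swap x y)) = - fieldProd b l := by
      rintro l x y hxy hl ⟨l₁, l₂, l₃, rfl⟩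
      have hfix : ∀ l' : List V, x ∉ l' → y ∉ l' → l'.map (Equiv.swap x y) = l' := by
        intro l' hx hy
        conv_rhs => rw [← List.map_id l']
        refine List.map_congr_left fun z hz => Equiv.swap_apply_of_ne_of_ne ?_ ?_
        · rintro rfl; exact hx hz
        · rintro rfl; exact hy hz
      simp only [List.nodup_append, List.nodup_cons, List.mem_append, List.mem_cons] at hl
      rw [fieldProd_swap hb x y]
      simp only [List.map_append, List.map_cons, Equiv.swap_apply_left, Equiv.swap_apply_right]
      rw [hfix l₁, hfix l₂, hfix l₃, neg_neg]
      all_goals grind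
    have hnd : (l.map f).Nodup := hl.map f.injective
    have hmem : ∀ p, p ∈ l.map f := fun p => List.mem_map.2 ⟨f.symm p, hm _, by simp⟩
    have hsw : fieldProd b ((l.map f).map (Equiv.swap x y)) = - fieldProd b (l.map f) := by
      obtain ⟨l₁, l₂, h12⟩ := List.append_of_mem (hmem x)
      have hy : y ∈ l₁ ++ x :: l₂ := h12 ▸ hmem y
      rw [List.mem_append, List.mem_cons] at hy
      rcases hy with hy | rfl | hy
      · obtain ⟨l₃, l₄, rfl⟩ := List.append_of_mem hy
        rw [Equiv.swap_comm]
        exact key _ _ _ hxy.symm hnd ⟨l₃, l₄, l₂, by simp [h12]⟩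
      · exact absurd rfl hxy
      · obtain ⟨l₃, l₄, rfl⟩ := List.append_of_mem hy
        exact key _ _ _ hxy hnd ⟨l₁, l₃, l₄, by simp [h12]⟩
    rw [List.map_map] at hsw
    rw [Equiv.Perm.coe_mul, hsw, ih, Equiv.Perm.sign_mul, Equiv.Perm.sign_swap hxy]
    simp

end Anticommuting

/-! ### From the Wick expansion to the permutation-sum Pfaffian. -/

section PfaffianFormula

variable {ι R : Type*} [Ring R] [Algebra ℂ R]

/-- The positions `(k, 0), (k, 1)`, `k ∈ l`, in order. -/
def pairList (l : List ι) : List (ι × Fin 2) := l.flatMap fun k => [(k, 0), (k, 1)]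

@[simp] theorem pairList_nil : pairList ([] : List ι) = [] := rfl

@[simp] theorem pairList_cons (k : ι) (l : List ι) :
    pairList (k :: l) = (k, 0) :: (k, 1) :: pairList l := by simp [pairList]

@[simp] theorem mem_pairList {l : List ι} {p : ι × Fin 2} : p ∈ pairList l ↔ p.1 ∈ l := by
  obtain ⟨k, i⟩ := p
  fin_cases i <;> simp [pairList]

@[simp] theorem length_pairList (l : List ι) : (pairList l).length = 2 * l.length := by
  induction l with
  | nil => rfl
  | cons k l ih => simp [ih]; ring

theorem nodup_pairList {l : List ι} (hl : l.Nodup) : (pairList l).Nodup := by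
  induction l with
  | nil => simp
  | cons k l ih => 
    rw [List.nodup_cons] at hl
    simp [ih hl.2, hl.1]

variable [Fintype ι] [DecidableEq ι]

/-- The antisymmetrized partial Wick expansion: the pairs in `ks` are contracted, those in `r`
are not. -/
def wickSum (φ : R →ₗ[ℂ] ℂ) (b : ι × Fin 2 → R) (g : ι × Fin 2 → ι × Fin 2 → ℂ) (ks r : List ι) :
    ℂ :=
  ∑ σ : Equiv.Perm (ι × Fin 2), ((Equiv.Perm.sign σ : ℤ) : ℂ) *
    ((ks.map fun k => g (σ (k, 0)) (σ (k, 1))).prod * φ (fieldProd b ((pairList r).map σ)))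

/-- Expanding the field at `(k₀, 0)` gives one term for each of the `2 * r.length + 1` other
uncontracted positions. After antisymmetrization all these terms coincide. -/
theorem wickSum_cons {φ : R →ₗ[ℂ] ℂ} {a c : ι × Fin 2 → R} {g : ι × Fin 2 → ι × Fin 2 → ℂ}
    (h : IsWick φ a c g) (hb : ∀ p q, (a + c) p * (a + c) q = - ((a + c) q * (a + c) p))
    (k₀ : ι) (ks r : List ι) (hk : k₀ ∉ ks) (hr : (k₀ :: r).Nodup) (hd : ∀ k ∈ r, k ∉ ks) :
    wickSum φ (a + c) g ks (k₀ :: r) =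
      (2 * r.length + 1 : ℕ) * wickSum φ (a + c) g (k₀ :: ks) r := by
  set L := (k₀, (1 : Fin 2)) :: pairList r with hL
  have hlen : L.length = 2 * r.length + 1 := by simp [hL]
  have hstep : wickSum φ (a + c) g ks (k₀ :: r) = ∑ j : Fin L.length,
      ∑ σ : Equiv.Perm (ι × Fin 2), ((Equiv.Perm.sign σ : ℤ) : ℂ) *
        ((ks.map fun k => g (σ (k, 0)) (σ (k, 1))).prod * ((-1) ^ (j : ℕ) * g (σ (k₀, 0)) (σ L[j]) *
          φ (fieldProd (a + c) ((L.eraseIdx j).map σ)))) := by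
    rw [Finset.sum_comm, wickSum]
    refine Finset.sum_congr rfl fun σ _ => ?_
    rw [← Finset.mul_sum, ← Finset.mul_sum]
    congr 2
    rw [pairList_cons, List.map_cons]
    refine (h.map_cons (σ (k₀, 0)) (L.map σ)).trans ?_
    refine Fintype.sum_equiv (finCongr (by simp)) _ _ fun j => ?_
    simp [List.eraseIdx_map]
  rw [hstep]
  have hterm : ∀ j : Fin L.length, (∑ σ : Equiv.Perm (ι × Fin 2), ((Equiv.Perm.sign σ : ℤ) : ℂ) *
        ((ks.map fun k => g (σ (k, 0)) (σ (k, 1))).prod * ((-1) ^ (j : ℕ) * g (σ (k₀, 0)) (σ L[j]) *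
          φ (fieldProd (a + c) ((L.eraseIdx j).map σ))))) = wickSum φ (a + c) g (k₀ :: ks) r := by
    rintro ⟨j, hj⟩
    cases j with
    | zero =>
      refine Finset.sum_congr rfl fun σ _ => ?_
      simp [hL]
      ring
    | succ j =>
      have hj' : j < (pairList r).length := by simpa [hL] using hj
      obtain ⟨l₁, y, l₂, hl, hlj⟩ : ∃ l₁ y l₂, pairList r = l₁ ++ y :: l₂ ∧ l₁.length = j :=
        ⟨(pairList r).take j, (pairList r)[j], (pairList r).drop (j + 1), by simp, by
          simp; simpa using hj'.le⟩
      have hyr : y.1 ∈ r := mem_pairList.1 (by simp [hl])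
      have hrn : k₀ ∉ r := (List.nodup_cons.1 hr).1
      have hnd : (l₁ ++ y :: l₂).Nodup := hl ▸ nodup_pairList (List.nodup_cons.1 hr).2
      have hyk : y ≠ (k₀, 1) := by rintro rfl; exact hrn hyr
      have hLy : L[j + 1]'hj = y := by
        simp [hL, hl, ← hlj]
      have hLe : L.eraseIdx (j + 1) = (k₀, 1) :: (l₁ ++ l₂) := by
        simp [hL, hl, ← hlj, List.eraseIdx_append_of_length_le]
      set τ := Equiv.swap (k₀, (1 : Fin 2)) y with hτ
      have hk1 : ∀ l' : List (ι × Fin 2), (∀ p ∈ l', p ∈ pairList r) → y ∉ l' → l'.map τ = l' := by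
        intro l' hx hy
        conv_rhs => rw [← List.map_id l']
        refine List.map_congr_left fun z hz => Equiv.swap_apply_of_ne_of_ne ?_ ?_
        · rintro rfl; exact hrn (mem_pairList.1 (hx _ hz))
        · rintro rfl; exact hy hz
      -- Replacing `σ` by `σ * τ` puts the contraction partner `y` in position `(k₀, 1)`. The
      -- contraction sign `(-1) ^ (j + 1)`, the sign `(-1) ^ j` for moving `(k₀, 1)` past `l₁`, and
      -- the sign of `τ` multiply to `1`.
      refine Fintype.sum_equiv (Equiv.mulRight τ) _ _ fun σ => ?_
      simp only [Fin.getElem_fin, hLy, hLe]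
      have hfix : ∀ k i, k ∉ r → (k, i) ≠ (k₀, (1 : Fin 2)) → τ (k, i) = (k, i) := fun k i h1 h2 =>
        Equiv.swap_apply_of_ne_of_ne h2 (by rintro rfl; exact h1 hyr)
      have hks : (ks.map fun k => g ((σ * τ) (k, 0)) ((σ * τ) (k, 1))) =
          ks.map fun k => g (σ (k, 0)) (σ (k, 1)) := by
        refine List.map_congr_left fun k hk' => ?_
        have h1 : k ∉ r := fun h => hd k h hk'
        have h2 : k ≠ k₀ := by rintro rfl; exact hk hk'
        rw [Equiv.Perm.mul_apply, Equiv.Perm.mul_apply, hfix k 0 h1 (by simp),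
          hfix k 1 h1 (by simp [h2])]
      have hmap : (pairList r).map (σ * τ) = (l₁ ++ (k₀, 1) :: l₂).map σ := by
        rw [Equiv.Perm.coe_mul, ← List.map_map]
        congr 1
        rw [List.nodup_append, List.nodup_cons] at hnd
        rw [hl, List.map_append, List.map_cons, hk1 l₁ (by simp +contextual [hl])
          (fun hy => hnd.2.2 _ hy y (by simp) rfl), hk1 l₂ (by simp +contextual [hl]) hnd.2.1.1,
          hτ, Equiv.swap_apply_right]
      have hmove : fieldProd (a + c) (((k₀, 1) :: (l₁ ++ l₂)).map σ) =
          (-1 : ℂ) ^ j • fieldProd (a + c) ((l₁ ++ (k₀, 1) :: l₂).map σ) := by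
        simp only [List.map_cons, List.map_append, fieldProd_cons, fieldProd_append]
        rw [← mul_assoc, mul_fieldProd_anticomm hb, List.length_map, hlj, smul_mul_assoc,
          mul_assoc]
      rw [Equiv.coe_mulRight, hmap, hmove, List.map_cons, List.prod_cons, hks,
        Equiv.Perm.sign_mul, hτ, Equiv.Perm.sign_swap hyk.symm, ← hτ, Equiv.Perm.mul_apply,
        Equiv.Perm.mul_apply, hfix k₀ 0 hrn (by simp), hτ, Equiv.swap_apply_left, map_smul,
        smul_eq_mul, pow_succ]
      have h1 : ((-1 : ℂ) ^ j) * (-1) ^ j = 1 := by rw [← mul_pow]; simp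
      push_cast
      linear_combination (-1 : ℂ) * ((Equiv.Perm.sign σ : ℤ) : ℂ) *
        (ks.map fun k => g (σ (k, 0)) (σ (k, 1))).prod * g (σ (k₀, 0)) (σ y) *
        φ (fieldProd (a + c) ((l₁ ++ (k₀, 1) :: l₂).map σ)) * h1
  rw [Finset.sum_congr rfl fun j _ => hterm j]
  simp [hlen]

/-- Contracting the `n` pairs of `r` one by one produces `(2n - 1)!! = (2n)! / (2ⁿ n!)`, which
accounts for the normalization of the Pfaffian. -/
theorem wickSum_mul_factorial {φ : R →ₗ[ℂ] ℂ} {a c : ι × Fin 2 → R}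
    {g : ι × Fin 2 → ι × Fin 2 → ℂ} (h : IsWick φ a c g)
    (hb : ∀ p q, (a + c) p * (a + c) q = - ((a + c) q * (a + c) p)) (r ks : List ι)
    (hr : r.Nodup) (hd : ∀ k ∈ r, k ∉ ks) :
    wickSum φ (a + c) g ks r * (2 ^ r.length * r.length.factorial : ℕ) =
      (2 * r.length).factorial * wickSum φ (a + c) g (r.reverse ++ ks) [] := by
  induction r generalizing ks with
  | nil => simp
  | cons k r ih =>
    rw [wickSum_cons h hb k ks r (hd k (by simp)) hr fun k' hk' => hd k' (by simp [hk'])]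
    have := ih (k :: ks) (List.nodup_cons.1 hr).2 fun k' hk' => by
      have h1 := hd k' (by simp [hk'])
      have h2 : k' ≠ k := by rintro rfl; exact (List.nodup_cons.1 hr).1 hk'
      simp [h1, h2]
    rw [List.reverse_cons, List.append_assoc, List.singleton_append, List.length_cons,
      show 2 * (r.length + 1) = 2 * r.length + 1 + 1 by ring, Nat.factorial_succ,
      Nat.factorial_succ, Nat.factorial_succ, pow_succ]
    push_cast at this ⊢
    linear_combination (2 * (r.length : ℂ) + 1) * (2 * (r.length + 1)) * this

/-- Wick's theorem for anticommuting fields, in terms of the Pfaffian. -/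
theorem IsWick.map_pairList_eq_pfaffian {φ : R →ₗ[ℂ] ℂ} {a c : ι × Fin 2 → R}
    {g : ι × Fin 2 → ι × Fin 2 → ℂ} (h : IsWick φ a c g)
    (hb : ∀ p q, (a + c) p * (a + c) q = - ((a + c) q * (a + c) p)) {l : List ι} (hl : l.Nodup)
    (hm : ∀ k, k ∈ l) :
    φ (fieldProd (a + c) (pairList l)) = pfaffian (Matrix.of g) := by
  have hcard : l.length = Fintype.card ι := by
    rw [← List.toFinset_card_of_nodup hl, Finset.eq_univ_of_forall (s := l.toFinset) (by simpa)]
    simp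
  have h1 := wickSum_mul_factorial h hb l [] hl (by simp)
  -- With nothing contracted, the sign of `σ` cancels the sign of reordering the fields, so all
  -- `(2n)!` terms are equal.
  have h2 : wickSum φ (a + c) g [] l = (2 * l.length).factorial *
      φ (fieldProd (a + c) (pairList l)) := by
    have : ∀ σ : Equiv.Perm (ι × Fin 2), ((Equiv.Perm.sign σ : ℤ) : ℂ) *
        φ (fieldProd (a + c) ((pairList l).map σ)) = φ (fieldProd (a + c) (pairList l)) := by
      intro σ
      rw [fieldProd_map_perm hb (nodup_pairList hl) (fun p => mem_pairList.2 (hm _)), map_smul,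
        smul_eq_mul, ← mul_assoc]
      rcases Int.units_eq_one_or (Equiv.Perm.sign σ) with hs | hs <;> simp [hs]
    simp only [wickSum, List.map_nil, List.prod_nil, one_mul, this]
    simp [Fintype.card_perm, hcard, mul_comm]
  have h3 : wickSum φ (a + c) g (l.reverse ++ []) [] = ∑ σ : Equiv.Perm (ι × Fin 2),
      ((Equiv.Perm.sign σ : ℤ) : ℂ) * ∏ k : ι, Matrix.of g (σ (k, 0)) (σ (k, 1)) := by
    refine Finset.sum_congr rfl fun σ _ => ?_
    congr 1
    rw [← Finset.eq_univ_of_forall (s := l.reverse.toFinset) (by simpa),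
      List.prod_toFinset _ (by simpa)]
    simp [h.map_one]
  rw [h2, h3] at h1
  have hf : ((2 * l.length).factorial : ℂ) ≠ 0 := by exact_mod_cast Nat.factorial_ne_zero _
  rw [pfaffian, ← hcard, eq_inv_mul_iff_mul_eq₀ (by simp [Nat.factorial_ne_zero])]
  apply mul_left_cancel₀ hf
  rw [← h1]
  push_cast
  ring

end PfaffianFormula

/-! ### Finite fermionic Fock spaces. -/

section Fock

open scoped Matrix ComplexOrder

/-- A finite-dimensional representation of the canonical anticommutation relations, with parity
operator `θ` and vacuum `v`. -/
structure IsFock {α m : Type*} [DecidableEq α] [Fintype m] [DecidableEq m] (c : α → Matrix m m ℂ)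
    (θ : Matrix m m ℂ) (v : m → ℂ) : Prop where
  anticomm : ∀ i j, c i * c j + c j * c i = 0
  anticomm_star : ∀ i j, c i * (c j)ᴴ + (c j)ᴴ * c i = if i = j then 1 else 0
  parity : ∀ i, θ * c i + c i * θ = 0
  parity_star : θᴴ = θ
  parity_sq : θ * θ = 1
  vacuum : ∀ i, c i *ᵥ v = 0
  norm_vacuum : star v ⬝ᵥ v = 1

/-- Jordan–Wigner construction: each new mode doubles the space. -/
theorem exists_isFock_fin (d : ℕ) : ∃ (m : Type) (_ : Fintype m) (_ : DecidableEq m)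
    (c : Fin d → Matrix m m ℂ) (θ : Matrix m m ℂ) (v : m → ℂ), IsFock c θ v := by
  induction d with
  | zero =>
    exact ⟨Unit, inferInstance, inferInstance, Fin.elim0, 1, 1, fun i => i.elim0, fun i => i.elim0,
      fun i => i.elim0, by simp, by simp, fun i => i.elim0, by simp⟩
  | succ d ih =>
    obtain ⟨m, _, _, c, θ, v, h⟩ := ih
    have hθ : ∀ i, θ * (c i)ᴴ + (c i)ᴴ * θ = 0 := fun i => by
      have := congrArg Matrix.conjTranspose (h.parity i)
      simp only [Matrix.conjTranspose_add, Matrix.conjTranspose_mul, h.parity_star,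
        Matrix.conjTranspose_zero] at this
      rw [← this, add_comm]
    have h0 : ∀ i, c i * θ + θ * c i = 0 := fun i => by rw [add_comm]; exact h.parity i
    have h0' : ∀ i, (c i)ᴴ * θ + θ * (c i)ᴴ = 0 := fun i => by rw [add_comm]; exact hθ i
    -- The block `θ` makes the new mode anticommute with the old ones, which act diagonally. The
    -- sign in the new parity operator makes it anticommute with the new mode as well.
    refine ⟨m ⊕ m, inferInstance, inferInstance,
      Fin.cons (Matrix.fromBlocks 0 θ 0 0) fun i => Matrix.fromBlocks (c i) 0 0 (c i),
      Matrix.fromBlocks θ 0 0 (-θ), Sum.elim v 0, ?_, ?_, ?_, ?_, ?_, ?_, ?_⟩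
    · intro i j
      refine Fin.cases ?_ (fun i => ?_) i <;> refine Fin.cases ?_ (fun j => ?_) j <;>
        simp [Matrix.fromBlocks_multiply, Matrix.fromBlocks_add, h.parity, h0, h.anticomm]
    · intro i j
      refine Fin.cases ?_ (fun i => ?_) i <;> refine Fin.cases ?_ (fun j => ?_) j
      · simp [Matrix.fromBlocks_multiply, Matrix.fromBlocks_add, h.parity_star, h.parity_sq,
          Matrix.fromBlocks_conjTranspose]
      · simp [Matrix.fromBlocks_multiply, Matrix.fromBlocks_add, hθ, (Fin.succ_ne_zero _).symm,
          Matrix.fromBlocks_conjTranspose]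
      · simp [Matrix.fromBlocks_multiply, Matrix.fromBlocks_add, h0, h.parity_star,
          Matrix.fromBlocks_conjTranspose]
      · by_cases hij : i = j <;>
        simp [Matrix.fromBlocks_multiply, Matrix.fromBlocks_add, h.anticomm_star,
          Matrix.fromBlocks_conjTranspose, hij]
    · intro i
      refine Fin.cases ?_ (fun i => ?_) i
      · simp [Matrix.fromBlocks_multiply, Matrix.fromBlocks_add, h.parity_sq]
      · have : -(θ * c i) + -(c i * θ) = 0 := by rw [← neg_add, h.parity, neg_zero]
        simp [Matrix.fromBlocks_multiply, Matrix.fromBlocks_add, h.parity, this]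
    · simp [Matrix.fromBlocks_conjTranspose, h.parity_star]
    · simp [Matrix.fromBlocks_multiply, h.parity_sq]
    · intro i
      refine Fin.cases ?_ (fun i => ?_) i <;> simp [Matrix.fromBlocks_mulVec, h.vacuum]
    · have : star (Sum.elim v (0 : m → ℂ)) = Sum.elim (star v) 0 := by ext (i | i) <;> simp
      rw [this, sumElim_dotProduct_sumElim, h.norm_vacuum]
      simp

theorem exists_isFock (α : Type*) [Fintype α] [DecidableEq α] :
    ∃ (m : Type) (_ : Fintype m) (_ : DecidableEq m)
      (c : α → Matrix m m ℂ) (θ : Matrix m m ℂ) (v : m → ℂ), IsFock c θ v := by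
  obtain ⟨m, i₁, i₂, c, θ, v, h⟩ := exists_isFock_fin (Fintype.card α)
  let e := Fintype.equivFin α
  exact ⟨m, i₁, i₂, fun a => c (e a), θ, v, fun i j => h.anticomm _ _,
    fun i j => by simp [h.anticomm_star], fun i => h.parity _, h.parity_star, h.parity_sq,
    fun i => h.vacuum _, h.norm_vacuum⟩

/-- The vector functional `M ↦ ⟨v, M v⟩`. -/
def vectorState {m : Type*} [Fintype m] (v : m → ℂ) : Matrix m m ℂ →ₗ[ℂ] ℂ where
  toFun M := star v ⬝ᵥ (M *ᵥ v)
  map_add' M N := by simp [Matrix.add_mulVec]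
  map_smul' a M := by simp [Matrix.smul_mulVec]

theorem vectorState_apply {m : Type*} [Fintype m] (v : m → ℂ) (M : Matrix m m ℂ) :
    vectorState v M = star v ⬝ᵥ (M *ᵥ v) := rfl

theorem vectorState_nonneg {m : Type*} [Fintype m] (v : m → ℂ) {M : Matrix m m ℂ}
    (hM : IsStarProjection M) : 0 ≤ vectorState v M := by
  have h1 : M = Mᴴ * M := by
    rw [← Matrix.star_eq_conjTranspose, hM.isSelfAdjoint.star_eq, hM.isIdempotentElem.eq]
  rw [h1, vectorState_apply, ← Matrix.mulVec_mulVec, Matrix.dotProduct_mulVec,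
    ← Matrix.star_mulVec]
  exact dotProduct_star_self_nonneg _

theorem IsFock.sum_anticomm {α m : Type*} [Fintype α] [DecidableEq α] [Fintype m] [DecidableEq m]
    {c : α → Matrix m m ℂ} {θ : Matrix m m ℂ} {v : m → ℂ} (h : IsFock c θ v) (u w : α → ℂ) :
    (∑ i, u i • c i) * (∑ i, w i • c i) + (∑ i, w i • c i) * (∑ i, u i • c i) = 0 := by
  simp only [Finset.sum_mul_sum]
  conv_lhs => enter [2]; rw [Finset.sum_comm]
  simp only [← Finset.sum_add_distrib]
  refine Finset.sum_eq_zero fun i _ => Finset.sum_eq_zero fun j _ => ?_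
  rw [smul_mul_smul_comm, smul_mul_smul_comm, mul_comm (w j), ← smul_add, h.anticomm, smul_zero]

/-- Linear combinations of annihilators and creators obey Wick's rule in the vacuum. -/
theorem IsFock.isWick {α m V : Type*} [Fintype α] [DecidableEq α] [Fintype m] [DecidableEq m]
    {c : α → Matrix m m ℂ} {θ : Matrix m m ℂ} {v : m → ℂ} (h : IsFock c θ v) (u w : V → α → ℂ) :
    IsWick (vectorState v) (fun p => ∑ i, u p i • c i) (fun p => ∑ i, w p i • (c i)ᴴ)
      (fun p q => ∑ i, u p i * w q i) where
  map_one := by simp [vectorState_apply, h.norm_vacuum]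
  map_annihilator p x := by
    rw [vectorState_apply, ← Matrix.mulVec_mulVec, Matrix.sum_mulVec]
    simp [Matrix.smul_mulVec, h.vacuum]
  map_creator p x := by
    rw [vectorState_apply, ← Matrix.mulVec_mulVec, Matrix.dotProduct_mulVec, Matrix.vecMul_sum]
    simp [Matrix.vecMul_smul, ← Matrix.star_mulVec, h.vacuum]
  anticomm p q := by
    have h1 := h.sum_anticomm (u p) (u q)
    have h2 : (∑ i, u p i • c i) * (∑ j, w q j • (c j)ᴴ) + (∑ j, w q j • (c j)ᴴ) * ∑ i, u p i • c i =
        (∑ i, u p i * w q i) • (1 : Matrix m m ℂ) := by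
      simp only [Finset.sum_mul_sum]
      conv_lhs => enter [2]; rw [Finset.sum_comm]
      simp only [← Finset.sum_add_distrib]
      rw [Finset.sum_smul]
      refine Finset.sum_congr rfl fun i _ => ?_
      have : ∀ j, (u p i • c i) * (w q j • (c j)ᴴ) + (w q j • (c j)ᴴ) * (u p i • c i) =
          if i = j then (u p i * w q i) • (1 : Matrix m m ℂ) else 0 := fun j => by
        rw [smul_mul_smul_comm, smul_mul_smul_comm, mul_comm (w q j), ← smul_add, h.anticomm_star]
        split_ifs with hij
        · rw [hij]
        · rw [smul_zero]
      rw [Finset.sum_congr rfl fun j _ => this j]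
      simp
    rw [Algebra.algebraMap_eq_smul_one, ← h2, mul_add, add_mul, ← sub_eq_zero, ← h1]
    abel

/-- Gives the canonical anticommutation relations of the fields for a two-point function, and exact
anticommutation for an antisymmetric contraction. -/
theorem IsWick.mul_anticomm {V R : Type*} [Ring R] [Algebra ℂ R] {φ : R →ₗ[ℂ] ℂ} {a c : V → R}
    {g : V → V → ℂ} (h : IsWick φ a c g) (ha : ∀ p q, a p * a q + a q * a p = 0)
    (hc : ∀ p q, c p * c q + c q * c p = 0) (p q : V) :
    (a + c) p * (a + c) q + (a + c) q * (a + c) p = algebraMap ℂ R (g p q + g q p) := by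
  rw [map_add, ← h.anticomm p q, ← h.anticomm q p]
  simp only [Pi.add_apply, mul_add, add_mul]
  rw [← add_zero (_ + _ : R), ← ha p q, ← sub_eq_zero, ← hc p q]
  abel

theorem IsFock.sum_anticomm_star {α m : Type*} [Fintype α] [DecidableEq α] [Fintype m]
    [DecidableEq m] {c : α → Matrix m m ℂ} {θ : Matrix m m ℂ} {v : m → ℂ} (h : IsFock c θ v)
    (u w : α → ℂ) : (∑ i, u i • (c i)ᴴ) * (∑ i, w i • (c i)ᴴ) +
      (∑ i, w i • (c i)ᴴ) * (∑ i, u i • (c i)ᴴ) = 0 := by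
  have := congrArg Matrix.conjTranspose (h.sum_anticomm (star w) (star u))
  simpa [Matrix.conjTranspose_sum, Matrix.conjTranspose_smul] using this

/-- The Pfaffian of an antisymmetric kernel as a vacuum expectation, and hence as that of any
other fields with the same ordered contractions. -/
theorem IsWick.map_pairList_eq_pfaffian_of_antisymm {ι R : Type*} [Fintype ι] [DecidableEq ι]
    [Ring R] [Algebra ℂ R] {φ : R →ₗ[ℂ] ℂ} {a c : ι × Fin 2 → R} {γ : ι × Fin 2 → ι × Fin 2 → ℂ}
    (h : IsWick φ a c γ) {G : Matrix (ι × Fin 2) (ι × Fin 2) ℂ} (hG : G.transpose = -G)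
    {l : List ι} (hl : l.Nodup) (hm : ∀ k, k ∈ l)
    (hp : (pairList l).Pairwise fun p q => γ p q = G p q) :
    φ (fieldProd (a + c) (pairList l)) = pfaffian G := by
  -- The given fields need not anticommute. They are compared with the model `a_p = f_p`, `c_q = ∑ᵢ
  -- G i q • (f_i)ᴴ`, whose contraction is the antisymmetric `G`, so that its fields do.
  obtain ⟨m, _, _, f, θ, v, hf⟩ := exists_isFock (ι × Fin 2)
  have hw := hf.isWick (fun p : ι × Fin 2 => Pi.single p 1) (fun q p => G p q)
  have hg : (fun p q => ∑ i, (Pi.single p 1 : ι × Fin 2 → ℂ) i * G i q) = fun p q => G p q := by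
    ext p q
    simp [Pi.single_apply]
  rw [hg] at hw
  rw [h.congr hw _ hp, hw.map_pairList_eq_pfaffian _ hl hm]
  · rfl
  · intro p q
    rw [← add_eq_zero_iff_eq_neg, hw.mul_anticomm]
    · have : G q p = - G p q := congrFun (congrFun hG p) q
      simp [this]
    · exact fun p q => hf.sum_anticomm _ _
    · exact fun p q => hf.sum_anticomm_star _ _

end Fock

/-! ### The kernel as a two-point function, and the number operators. -/

section Fields

variable {𝔛 : Type*}

/-- The basis vectors `(e_x, 0)` and `(0, e_x)` of the doubled space. -/
noncomputable def basisVec (p : 𝔛 × Fin 2) : Doubled 𝔛 := if p.2 = 0 then pair (e p.1) 0 else pair 0 (e p.1)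

/-- The action of `Γ` on the index set of the basis. -/
def bar (p : 𝔛 × Fin 2) : 𝔛 × Fin 2 := (p.1, p.2.rev)

@[simp] theorem bar_bar (p : 𝔛 × Fin 2) : bar (bar p) = p := by simp [bar]

theorem J_e (x : 𝔛) : J (e x) = e x := by
  classical
  ext y
  simp only [J, e, lp.star_apply, lp.single_apply]
  by_cases h : y = x
  · subst h; simp
  · simp [h]

theorem J_zero : J (0 : Ell2 𝔛) = 0 := star_zero _

theorem Γ_basisVec (p : 𝔛 × Fin 2) : Γ (basisVec p) = basisVec (bar p) := by
  obtain ⟨x, i⟩ := p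
  fin_cases i <;> simp [basisVec, bar, Γ, pair, J_e, J_zero]

theorem Γ_Γ (f : Doubled 𝔛) : Γ (Γ f) = f := by
  simp [Γ, pair, J]
  rfl

theorem inner_J_J (u v : Ell2 𝔛) : inner ℂ (J u) (J v) = inner ℂ v u := by
  simp [lp.inner_eq_tsum, J, mul_comm]

theorem inner_Γ_Γ (f g : Doubled 𝔛) : inner ℂ (Γ f) (Γ g) = inner ℂ g f := by
  simp [Γ, pair, WithLp.prod_inner_apply, inner_J_J, add_comm]

theorem inner_e_left (x : 𝔛) (u : Ell2 𝔛) : inner ℂ (e x) u = u x := by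
  simp [e, lp.inner_single_left]

open Classical in
theorem inner_e_e (x y : 𝔛) : inner ℂ (e x) (e y) = if x = y then (1 : ℂ) else 0 := by
  rw [inner_e_left, e, lp.single_apply, Pi.single_apply]

open Classical in
theorem inner_basisVec (p q : 𝔛 × Fin 2) :
    inner ℂ (basisVec p) (basisVec q) = if p = q then (1 : ℂ) else 0 := by
  obtain ⟨x, i⟩ := p
  obtain ⟨y, j⟩ := q
  fin_cases i <;> fin_cases j <;>
    simp [basisVec, pair, WithLp.prod_inner_apply, inner_e_e]

/-- The two-point function `(Γ f_p, S f_q)` of the quasi-free state with covariance `S`. -/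
noncomputable def twoPoint (S : Doubled 𝔛 →L[ℂ] Doubled 𝔛) (p q : 𝔛 × Fin 2) : ℂ :=
  inner ℂ (basisVec (bar p)) (S (basisVec q))

open Classical in
-- By antiunitarity of `Γ`, the relation `Γ S Γ = 1 - S` becomes the canonical anticommutation
-- relation at the level of two-point functions.
theorem twoPoint_add_swap {S : Doubled 𝔛 →L[ℂ] Doubled 𝔛} (hS : IsCovariance S)
    (p q : 𝔛 × Fin 2) : twoPoint S p q + twoPoint S q p = if bar p = q then 1 else 0 := by
  have h1 : S (basisVec p) = Γ (basisVec (bar p) - S (basisVec (bar p))) := by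
    have := hS.conj_eq (basisVec (bar p))
    simp only [sub_apply, one_apply_eq_self] at this
    rw [← this, Γ_Γ, Γ_basisVec, bar_bar]
  have h2 : twoPoint S q p = inner ℂ (basisVec (bar p)) (basisVec q) - twoPoint S p q := by
    rw [twoPoint, h1, ← Γ_basisVec q, inner_Γ_Γ, inner_sub_left, twoPoint]
    congr 1
    exact (ContinuousLinearMap.isSelfAdjoint_iff_isSymmetric.1 hS.isSelfAdjoint) _ _
  rw [h2, inner_basisVec]
  ring

open Classical in
-- The `-1` in the kernel removes exactly the anticommutator at coincident points, which makes the
-- kernel antisymmetric.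
theorem kernel_eq_twoPoint (S : Doubled 𝔛 →L[ℂ] Doubled 𝔛) (x y : 𝔛) (i j : Fin 2) :
    kernel S x y i j =
      twoPoint S (x, i) (y, j) - if i = 1 ∧ j = 0 ∧ x = y then (1 : ℂ) else 0 := by
  fin_cases i <;> fin_cases j <;>
    simp [kernel, twoPoint, bar, basisVec, pair, WithLp.prod_inner_apply, inner_e_e]

theorem kernel_transpose {S : Doubled 𝔛 →L[ℂ] Doubled 𝔛} (hS : IsCovariance S) (x y : 𝔛) :
    (kernel S x y).transpose = - kernel S y x := by
  classical
  ext i j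
  rw [Matrix.transpose_apply, Matrix.neg_apply, ← add_eq_zero_iff_eq_neg, kernel_eq_twoPoint,
    kernel_eq_twoPoint]
  have := twoPoint_add_swap hS (x, j) (y, i)
  rw [sub_add_sub_comm, this]
  fin_cases i <;> fin_cases j <;> simp [bar, eq_comm]

theorem kernelMatrix_transpose {K : 𝔛 → 𝔛 → Matrix (Fin 2) (Fin 2) ℂ}
    (hK : ∀ x y, (K x y).transpose = - K y x) {n : ℕ} (x : Fin n → 𝔛) :
    (kernelMatrix K x).transpose = - kernelMatrix K x := by
  ext p q
  exact congrFun (congrFun (hK (x q.1) (x p.1)) p.2) q.2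

/-- Coordinates in an orthonormal basis of the span; a Fock space with finitely many modes then
suffices for a finite window. -/
theorem exists_gram {ι H : Type*} [Finite ι] [NormedAddCommGroup H] [InnerProductSpace ℂ H]
    (F : ι → H) : ∃ (d : ℕ) (w : ι → Fin d → ℂ),
      ∀ p q, ∑ i, star (w p i) * w q i = inner ℂ (F p) (F q) := by
  let V := Submodule.span ℂ (Set.range F)
  have : FiniteDimensional ℂ V := FiniteDimensional.span_of_finite ℂ (Set.finite_range F)
  let G : ι → V := fun p => ⟨F p, Submodule.subset_span ⟨p, rfl⟩⟩
  let b := stdOrthonormalBasis ℂ V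
  refine ⟨_, fun p i => inner ℂ (b i) (G p), fun p q => ?_⟩
  simpa [V, G] using b.sum_inner_mul_inner (G p) (G q)

open scoped Matrix

/-- The fields `β p` built from the Gram vectors of `P f_p` satisfy `star (β p) = β (bar p)`, and `N
x = β (x, 0) * β (x, 1)` is the occupation number at `x`. -/
theorem exists_numberOperators {P : Doubled 𝔛 →L[ℂ] Doubled 𝔛} (hP : P ∈ Gr 𝔛) (A : Finset 𝔛) :
    ∃ (m : Type) (_ : Fintype m) (_ : DecidableEq m) (N : A → Matrix m m ℂ) (v : m → ℂ),
      (∀ x, IsStarProjection (N x)) ∧ (∀ x y, Commute (N x) (N y)) ∧ star v ⬝ᵥ v = 1 ∧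
      ∀ (n : ℕ) (x : Fin n → A), Function.Injective x →
        vectorState v ((List.finRange n).map (N ∘ x)).prod =
          pfaffian (kernelMatrix (kernel P) fun i => (x i : 𝔛)) := by
  classical
  let ι : A × Fin 2 → 𝔛 × Fin 2 := fun p => (p.1, p.2)
  have hι : Function.Injective ι := fun p q h => 
    Prod.ext (Subtype.ext (Prod.ext_iff.1 h).1) (Prod.ext_iff.1 h).2
  have hbar : ∀ p, ι (bar p) = bar (ι p) := fun p => rfl
  obtain ⟨d, w, hw⟩ := exists_gram fun p : A × Fin 2 => P (basisVec (ι p))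
  obtain ⟨m, _, _, c, θ, v, h⟩ := exists_isFock_fin d
  have hsym := ContinuousLinearMap.isSelfAdjoint_iff_isSymmetric.1 hP.1.isSelfAdjoint
  have hW := h.isWick (fun p i => star (w (bar p) i)) w
  have hg : (fun p q => ∑ i, star (w (bar p) i) * w q i) =
      fun p q => twoPoint P (ι p) (ι q) := by
    ext p q
    rw [hw, hbar, hsym.apply_clm, twoPoint, ← mul_apply_eq_comp, hP.2]
  rw [hg] at hW
  set a : A × Fin 2 → Matrix m m ℂ := fun p => ∑ i, star (w (bar p) i) • c i with ha
  set c' : A × Fin 2 → Matrix m m ℂ := fun p => ∑ i, w p i • (c i)ᴴ with hc'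
  set β := a + c' with hβ
  have hstar : ∀ p, star (β p) = β (bar p) := fun p => by
    simp [hβ, ha, hc', Matrix.star_eq_conjTranspose, add_comm]
  have hcar : ∀ p q, β p * β q + β q * β p = if bar p = q then 1 else 0 := fun p q => by
    rw [hβ, hW.mul_anticomm (fun p q => h.sum_anticomm _ _) (fun p q => h.sum_anticomm_star _ _),
      twoPoint_add_swap hP.1, ← hbar]
    simp only [hι.eq_iff]
    split_ifs <;> simp
  let N : A → Matrix m m ℂ := fun x => β (x, 0) * β (x, 1)
  have hsq : ∀ p, β p * β p = 0 := fun p => by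
    have := hcar p p
    rw [if_neg, ← two_smul ℂ, smul_eq_zero] at this
    · simpa using this
    · obtain ⟨x, i⟩ := p
      fin_cases i <;> simp [bar]
  refine ⟨m, inferInstance, inferInstance, N, v, fun x => ⟨?_, ?_⟩, fun x y => ?_,
    h.norm_vacuum, fun n x hx => ?_⟩
  · have h1 : β (x, 1) * β (x, 0) = 1 - β (x, 0) * β (x, 1) := by
      rw [eq_sub_iff_add_eq, hcar, if_pos (by simp [bar])]
    change β (x, 0) * β (x, 1) * (β (x, 0) * β (x, 1)) = β (x, 0) * β (x, 1)
    rw [mul_assoc, ← mul_assoc (β (x, 1)), h1, sub_mul, mul_assoc (β (x, 0)), hsq]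
    simp
  · change star (β (x, 0) * β (x, 1)) = _
    rw [star_mul, hstar, hstar]
    simp [bar, N]
  · by_cases hxy : x = y
    · rw [hxy]
    · have key : ∀ i j, β (x, i) * β (y, j) = - (β (y, j) * β (x, i)) := fun i j => by
        rw [← add_eq_zero_iff_eq_neg, hcar, if_neg (by simp [bar, hxy])]
      have key2 : ∀ i, β (x, i) * (β (y, 0) * β (y, 1)) = β (y, 0) * β (y, 1) * β (x, i) := by
        intro i
        rw [← mul_assoc, key, neg_mul, mul_assoc, key, mul_neg, neg_neg, mul_assoc]
      change β (x, 0) * β (x, 1) * (β (y, 0) * β (y, 1)) =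
        β (y, 0) * β (y, 1) * (β (x, 0) * β (x, 1))
      rw [mul_assoc, key2, ← mul_assoc, key2, mul_assoc]
  · let κ : Fin n × Fin 2 → A × Fin 2 := fun p => (x p.1, p.2)
    have hWx : IsWick (vectorState v) (a ∘ κ) (c' ∘ κ)
        (fun p q => twoPoint P (ι (κ p)) (ι (κ q))) :=
      ⟨hW.map_one, fun p => hW.map_annihilator _, fun p => hW.map_creator _,
        fun p q => hW.anticomm _ _⟩
    rw [← hWx.map_pairList_eq_pfaffian_of_antisymm
      (kernelMatrix_transpose (kernel_transpose hP.1) _) (List.nodup_finRange n)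
      List.mem_finRange]
    · congr 1
      generalize List.finRange n = l
      induction l with
      | nil => simp
      | cons k l ih =>
        rw [List.map_cons, List.prod_cons, ih]
        simp [N, κ, hβ, mul_assoc]
    -- Each `(k, 0)` precedes `(k, 1)` and the points are distinct, so the correction in
    -- `kernel_eq_twoPoint` never meets an ordered contraction.
    · rw [pairList, List.pairwise_flatMap]
      refine ⟨fun k _ => ?_, ?_⟩
      · simp [kernelMatrix, kernel_eq_twoPoint, ι, κ]
      · refine (List.nodup_finRange n).imp fun {k k'} hkk => ?_
        simp [kernelMatrix, kernel_eq_twoPoint, ι, κ, hx.eq_iff, hkk]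

end Fields

/-! ### Measures on configurations from their correlations. -/

section Config

variable {𝔛 : Type*}

/-- Inclusion–exclusion: the weight of the event that all of `S` and nothing of `A` is occupied. -/
def sieve [DecidableEq 𝔛] (ρ : Finset 𝔛 → ℝ) (S A : Finset 𝔛) : ℝ :=
  ∑ T ∈ A.powerset, (-1) ^ T.card * ρ (S ∪ T)

theorem sieve_empty [DecidableEq 𝔛] (ρ : Finset 𝔛 → ℝ) (S : Finset 𝔛) : sieve ρ S ∅ = ρ S := by
  simp [sieve]

theorem sieve_insert [DecidableEq 𝔛] (ρ : Finset 𝔛 → ℝ) (S A : Finset 𝔛) {x : 𝔛} (hx : x ∉ A) :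
    sieve ρ S (insert x A) = sieve ρ S A - sieve ρ (insert x S) A := by
  rw [sieve, Finset.sum_powerset_insert hx, sieve, sieve, sub_eq_add_neg,
    ← Finset.sum_neg_distrib]
  congr 1
  refine Finset.sum_congr rfl fun T hT => ?_
  have hxT : x ∉ T := fun h => hx (Finset.mem_powerset.1 hT h)
  rw [Finset.card_insert_of_notMem hxT, pow_succ, Finset.union_insert, Finset.insert_union]
  ring

/-- Split according to the set `T` of points of `A` that are occupied. This shows that the measure
built from the sieve weights has the prescribed correlations. -/
theorem sum_sieve [DecidableEq 𝔛] (ρ : Finset 𝔛 → ℝ) (S A : Finset 𝔛) :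
    ∑ T ∈ A.powerset, sieve ρ (S ∪ T) (A \ T) = ρ S := by
  induction A using Finset.induction_on generalizing S with
  | empty => simp [sieve_empty]
  | insert x A hx ih =>
    rw [Finset.sum_powerset_insert hx, ← ih S, ← Finset.sum_add_distrib]
    refine Finset.sum_congr rfl fun T hT => ?_
    have hxT : x ∉ T := fun h => hx (Finset.mem_powerset.1 hT h)
    rw [Finset.insert_sdiff_of_notMem _ hxT, sieve_insert _ _ _ (by simp [hx]),
      Finset.insert_sdiff_insert, Finset.sdiff_insert_of_notMem hx, Finset.union_insert]
    ring

/-- The configurations occupying all of `S`. -/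
def finsetCylinder (S : Finset 𝔛) : Set (Config 𝔛) := {ω | ∀ x ∈ S, ω x = true}

theorem measurableSet_finsetCylinder (S : Finset 𝔛) : MeasurableSet (finsetCylinder S) := by
  have : finsetCylinder S = ⋂ x ∈ S, (fun ω : Config 𝔛 => ω x) ⁻¹' {true} := by
    ext ω; simp [finsetCylinder]
  rw [this]
  exact Finset.measurableSet_biInter _ fun x _ =>
    measurable_pi_apply x (measurableSet_singleton true)

theorem isClopen_finsetCylinder (S : Finset 𝔛) : IsClopen (finsetCylinder S) := by
  have : finsetCylinder S = ⋂ x ∈ S, (fun ω : Config 𝔛 => ω x) ⁻¹' {true} := by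
    ext ω; simp [finsetCylinder]
  rw [this]
  exact isClopen_biInter_finset fun x _ => (isClopen_discrete {true}).preimage (continuous_apply x)

open Classical in
/-- A finite-volume measure with prescribed correlations inside `A`. -/
theorem exists_finite_volume_measure {ρ : Finset 𝔛 → ℝ} (h0 : ρ ∅ = 1)
    (hpos : ∀ S A, Disjoint S A → 0 ≤ sieve ρ S A) (A : Finset 𝔛) :
    ∃ M : ProbabilityMeasure (Config 𝔛), ∀ S ⊆ A,
      (M : Measure (Config 𝔛)) (finsetCylinder S) = ENNReal.ofReal (ρ S) := by
  let M : Measure (Config 𝔛) := ∑ T ∈ A.powerset,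
    ENNReal.ofReal (sieve ρ T (A \ T)) • Measure.dirac (fun x => decide (x ∈ T))
  have hM : ∀ S ⊆ A, M (finsetCylinder S) = ENNReal.ofReal (ρ S) := by
    intro S hS
    have h1 : ∀ T, Measure.dirac (fun x => decide (x ∈ T)) (finsetCylinder S) =
        if S ⊆ T then (1 : ENNReal) else 0 := fun T => by
      rw [Measure.dirac_apply' _ (measurableSet_finsetCylinder S), Set.indicator_apply]
      simp [finsetCylinder, Finset.subset_iff]
    simp only [M, Measure.finsetSum_apply, Measure.smul_apply, h1, smul_eq_mul, mul_ite, mul_one,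
      mul_zero]
    rw [← Finset.sum_filter, ← sum_sieve ρ S (A \ S), ENNReal.ofReal_sum_of_nonneg]
    -- Sets between `S` and `A` correspond to subsets of `A \ S`.
    · refine Finset.sum_bij' (fun T _ => T \ S) (fun T _ => S ∪ T) ?_ ?_ ?_ ?_ ?_
      · intro T hT
        simp only [Finset.mem_filter, Finset.mem_powerset] at hT ⊢
        exact Finset.sdiff_subset_sdiff hT.1 le_rfl
      · intro T hT
        simp only [Finset.mem_filter, Finset.mem_powerset] at hT ⊢
        exact ⟨Finset.union_subset hS (hT.trans Finset.sdiff_subset), Finset.subset_union_left⟩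
      · intro T hT
        simp only [Finset.mem_filter, Finset.mem_powerset] at hT
        exact Finset.union_sdiff_of_subset hT.2
      · intro T hT
        rw [Finset.mem_powerset] at hT
        exact Finset.union_sdiff_cancel_left
          (Finset.disjoint_sdiff.mono_right hT)
      · intro T hT
        simp only [Finset.mem_filter, Finset.mem_powerset] at hT
        rw [Finset.union_sdiff_of_subset hT.2]
        congr 2
        ext x
        have := @hT.2 x
        simp only [Finset.mem_sdiff]
        tauto
    · intro T hT
      apply hpos
      rw [Finset.disjoint_union_left]
      exact ⟨Finset.disjoint_sdiff.mono_right Finset.sdiff_subset, Finset.disjoint_sdiff⟩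
  have hp : IsProbabilityMeasure M := ⟨by
    have : finsetCylinder (∅ : Finset 𝔛) = Set.univ := by ext; simp [finsetCylinder]
    rw [← this, hM ∅ (by simp), h0, ENNReal.ofReal_one]⟩
  exact ⟨⟨M, hp⟩, hM⟩

open Classical in
-- Probability measures on the compact configuration space form a compact space, so the
-- finite-volume measures converge along an ultrafilter. Cylinders are clopen, hence their
-- probabilities pass to the limit, and along growing windows these are eventually constant.
theorem exists_measure_of_sieve_nonneg [Countable 𝔛] {ρ : Finset 𝔛 → ℝ} (h0 : ρ ∅ = 1)
    (hpos : ∀ S A, Disjoint S A → 0 ≤ sieve ρ S A) :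
    ∃ M : Measure (Config 𝔛), IsProbabilityMeasure M ∧ ∀ S, M.real (finsetCylinder S) = ρ S := by
  have hρ : ∀ S, 0 ≤ ρ S := fun S => by simpa [sieve_empty] using hpos S ∅ (by simp)
  choose M hM using exists_finite_volume_measure h0 hpos
  let U : Ultrafilter (Finset 𝔛) := Ultrafilter.of Filter.atTop
  have hU : (U : Filter (Finset 𝔛)) ≤ Filter.atTop := Ultrafilter.of_le _
  obtain ⟨M₀, -, hM₀⟩ := isCompact_univ.ultrafilter_le_nhds (U.map M) (by simp)
  have hlim : Filter.Tendsto M U (nhds M₀) := hM₀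
  refine ⟨M₀, inferInstance, fun S => ?_⟩
  have h1 := ProbabilityMeasure.tendsto_measure_of_null_frontier_of_tendsto' hlim
    (E := finsetCylinder S) (by rw [(isClopen_finsetCylinder S).frontier_eq]; simp)
  have h2 : Filter.Tendsto (fun A => (M A : Measure (Config 𝔛)) (finsetCylinder S)) U
      (nhds (ENNReal.ofReal (ρ S))) := by
    refine Filter.Tendsto.congr' ?_ tendsto_const_nhds
    filter_upwards [hU (Filter.Ici_mem_atTop S)] with A hA using (hM A S hA).symm
  rw [Measure.real, tendsto_nhds_unique h1 h2, ENNReal.toReal_ofReal (hρ S)]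

theorem ext_of_finsetCylinder [Countable 𝔛] {M M' : Measure (Config 𝔛)} [IsProbabilityMeasure M]
    [IsProbabilityMeasure M'] (h : ∀ S, M (finsetCylinder S) = M' (finsetCylinder S)) : M = M' := by
  classical
  refine ext_of_generate_finite (Set.range finsetCylinder) ?_ ?_ ?_ (by simp)
  · refine le_antisymm ?_ (MeasurableSpace.generateFrom_le ?_)
    · refine iSup_le fun x => ?_
      rw [← measurable_iff_comap_le]
      refine @measurable_to_bool _ (MeasurableSpace.generateFrom _) _ ?_
      refine MeasurableSpace.measurableSet_generateFrom ⟨{x}, ?_⟩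
      ext ω
      simp [finsetCylinder]
    · rintro _ ⟨S, rfl⟩
      exact measurableSet_finsetCylinder S
  · rintro _ ⟨S, rfl⟩ _ ⟨T, rfl⟩ -
    refine ⟨S ∪ T, ?_⟩
    ext ω
    simp [finsetCylinder, or_imp, forall_and]
  · rintro _ ⟨S, rfl⟩
    exact h S

theorem cylinder_eq_finsetCylinder [DecidableEq 𝔛] {n : ℕ} (x : Fin n → 𝔛) :
    cylinder x = finsetCylinder (Finset.univ.image x) := by
  ext ω; simp [cylinder, finsetCylinder]

end Config

/-! ### Existence and uniqueness of the Pfaffian process. -/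

section PfaffianMeasure

open scoped ComplexOrder

theorem pfaffian_submatrix {ι κ : Type*} [Fintype ι] [DecidableEq ι] [Fintype κ] [DecidableEq κ]
    (A : Matrix (ι × Fin 2) (ι × Fin 2) ℂ) (f : κ ≃ ι) :
    pfaffian (A.submatrix (Prod.map f id) (Prod.map f id)) = pfaffian A := by
  rw [pfaffian, pfaffian, Fintype.card_congr f]
  congr 1
  let F : κ × Fin 2 ≃ ι × Fin 2 := f.prodCongr (Equiv.refl _)
  refine Fintype.sum_equiv F.permCongr _ _ fun σ => ?_
  rw [Equiv.Perm.sign_permCongr]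
  congr 1
  refine Fintype.prod_equiv f _ _ fun k => ?_
  simp [F, Equiv.permCongr_apply, Prod.map]

/-- Transposing two positions with equal kernel entries flips the sign of every permutation and
preserves its product. -/
theorem pfaffian_kernelMatrix_of_not_injective {𝔛 : Type*}
    (K : 𝔛 → 𝔛 → Matrix (Fin 2) (Fin 2) ℂ) {n : ℕ} {x : Fin n → 𝔛}
    (hx : ¬ Function.Injective x) : pfaffian (kernelMatrix K x) = 0 := by
  obtain ⟨i, j, hij, hne⟩ : ∃ i j, x i = x j ∧ i ≠ j := by
    simpa [Function.Injective] using hx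
  let τ : Equiv.Perm (Fin n × Fin 2) := Equiv.swap (i, 0) (j, 0)
  have hs : Equiv.Perm.sign τ = -1 := Equiv.Perm.sign_swap (by simp [hne])
  have hτ : ∀ p, x (τ p).1 = x p.1 ∧ (τ p).2 = p.2 := by
    intro p
    simp only [τ, Equiv.swap_apply_def]
    split_ifs with h1 h2
    · simp [h1, hij]
    · simp [h2, hij]
    · simp
  rw [pfaffian, mul_eq_zero]
  right
  rw [← self_eq_neg, ← Finset.sum_neg_distrib]
  refine Fintype.sum_equiv (Equiv.mulLeft τ) _ _ fun σ => ?_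
  simp [kernelMatrix, hs, hτ]

variable {𝔛 : Type*}

open Classical in
/-- The Pfaffian of the kernel restricted to a finite set of points. -/
noncomputable def finsetPfaffian (K : 𝔛 → 𝔛 → Matrix (Fin 2) (Fin 2) ℂ) (S : Finset 𝔛) : ℂ :=
  pfaffian (Matrix.of fun p q : S × Fin 2 => K p.1 q.1 p.2 q.2)

theorem pfaffian_kernelMatrix [DecidableEq 𝔛] (K : 𝔛 → 𝔛 → Matrix (Fin 2) (Fin 2) ℂ) {n : ℕ}
    {x : Fin n → 𝔛} (hx : Function.Injective x) :
    pfaffian (kernelMatrix K x) = finsetPfaffian K (Finset.univ.image x) := by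
  classical
  let f : Fin n ≃ (Finset.univ.image x : Finset 𝔛) := Equiv.ofBijective
    (fun i => ⟨x i, by simp⟩) ⟨fun i j h => hx (congrArg Subtype.val h), fun ⟨y, hy⟩ => by
      simpa [Subtype.ext_iff] using hy⟩
  have := pfaffian_submatrix
    (Matrix.of fun p q : ↥(Finset.univ.image x) × Fin 2 => K p.1 q.1 p.2 q.2) f
  unfold finsetPfaffian
  convert this
  rfl

theorem setPairwise_commute {α R : Type*} [Mul R] {N : α → R} (hc : ∀ x y, Commute (N x) (N y))
    (s : Set α) : s.Pairwise (Function.onFun Commute N) := fun x _ y _ _ => hc x y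

theorem isStarProjection_noncommProd {α R : Type*} [Ring R] [StarRing R] {N : α → R}
    (hN : ∀ x, IsStarProjection (N x)) (hc : ∀ x y, Commute (N x) (N y)) (S : Finset α) :
    IsStarProjection (S.noncommProd N (setPairwise_commute hc _)) := by
  classical
  induction S using Finset.induction_on with
  | empty => simp
  | insert x S hx ih =>
    rw [Finset.noncommProd_insert_of_notMem _ _ _ _ hx]
    exact (hN x).mul ih (Finset.noncommProd_commute _ _ _ _ fun y _ => hc x y)

open Classical in
-- Splitting off one factor `1 - N x` reproduces the recursion `sieve_insert`.
theorem re_map_noncommProd_eq_sieve {R : Type*} [Ring R] [Algebra ℂ R] {φ : R →ₗ[ℂ] ℂ} {N : 𝔛 → R}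
    (hc : ∀ x y, Commute (N x) (N y)) (hc' : ∀ x y, Commute (1 - N x) (1 - N y))
    {ρ : Finset 𝔛 → ℝ} {A : Finset 𝔛}
    (hρ : ∀ S ⊆ A, (φ (S.noncommProd N (setPairwise_commute hc _))).re = ρ S) {S B : Finset 𝔛}
    (hS : S ⊆ A) (hB : B ⊆ A) (hd : Disjoint S B) :
    (φ (S.noncommProd N (setPairwise_commute hc _) *
      B.noncommProd (fun x => 1 - N x) (setPairwise_commute hc' _))).re = sieve ρ S B := by
  induction B using Finset.induction_on generalizing S with
  | empty => simp [sieve_empty, hρ S hS]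
  | insert x B hx ih =>
    rw [Finset.disjoint_insert_right] at hd
    rw [Finset.insert_subset_iff] at hB
    have h1 := ih hS hB.2 hd.2
    have h2 := ih (Finset.insert_subset hB.1 hS) hB.2 (Finset.disjoint_insert_left.2 ⟨hx, hd.2⟩)
    rw [sieve_insert _ _ _ hx, ← h1, ← h2, Finset.noncommProd_insert_of_notMem _ _ _ _ hx,
      Finset.noncommProd_insert_of_notMem' _ _ _ _ hd.1, ← Complex.sub_re, ← map_sub]
    congr 2
    noncomm_ring

open Classical in
theorem exists_commuting_projections {P : Doubled 𝔛 →L[ℂ] Doubled 𝔛} (hP : P ∈ Gr 𝔛)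
    (A : Finset 𝔛) : ∃ (m : Type) (_ : Fintype m) (_ : DecidableEq m) (N : 𝔛 → Matrix m m ℂ)
      (v : m → ℂ) (hc : ∀ x y, Commute (N x) (N y)), (∀ x, IsStarProjection (N x)) ∧
      ∀ S ⊆ A, vectorState v (S.noncommProd N (setPairwise_commute hc _)) =
        finsetPfaffian (kernel P) S := by
  obtain ⟨m, i₁, i₂, N, v, hN, hc, -, hpf⟩ := exists_numberOperators hP A
  -- The value `1` outside `A` keeps a family of commuting projections and never enters a product
  -- over `S ⊆ A`.
  let N' : 𝔛 → Matrix m m ℂ := fun x => if h : x ∈ A then N ⟨x, h⟩ else 1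
  have hc' : ∀ x y, Commute (N' x) (N' y) := by
    intro x y
    simp only [N']
    split_ifs
    · exact hc _ _
    · exact Commute.one_right _
    · exact Commute.one_left _
    · exact Commute.one_left _
  refine ⟨m, i₁, i₂, N', v, hc', fun x => ?_, fun S hS => ?_⟩
  · simp only [N']
    split_ifs
    · exact hN _
    · exact IsStarProjection.one _
  · let x : Fin S.card → A := fun i => ⟨S.equivFin.symm i, hS (S.equivFin.symm i).2⟩
    have hx : Function.Injective fun i => (x i : 𝔛) := fun i j h =>
      S.equivFin.symm.injective (Subtype.ext h)
    have hxS : Finset.univ.image (fun i => (x i : 𝔛)) = S := by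
      ext y
      simp only [Finset.mem_image, Finset.mem_univ, true_and]
      exact ⟨by rintro ⟨i, rfl⟩; exact (S.equivFin.symm i).2,
        fun hy => ⟨S.equivFin ⟨y, hy⟩, by simp [x]⟩⟩
    have h1 := hpf _ x fun i j h => hx (congrArg Subtype.val h)
    rw [pfaffian_kernelMatrix _ hx, hxS] at h1
    rw [← h1]
    congr 1
    have hl : ((List.finRange S.card).map fun i => (x i : 𝔛)).toFinset = S := by
      conv_rhs => rw [← hxS]
      ext y
      simp
    have h2 := Finset.noncommProd_toFinset ((List.finRange S.card).map fun i => (x i : 𝔛)) N'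
      (setPairwise_commute hc' _) ((List.nodup_finRange _).map hx)
    simp only [hl] at h2
    rw [h2, List.map_map]
    congr 1
    refine List.map_congr_left fun i _ => ?_
    simp [N']

/-- In the partial order of `ℂ` this also says that the Pfaffian is real, as a correlation must be.
-/
theorem finsetPfaffian_nonneg {P : Doubled 𝔛 →L[ℂ] Doubled 𝔛} (hP : P ∈ Gr 𝔛) (S : Finset 𝔛) :
    0 ≤ finsetPfaffian (kernel P) S := by
  obtain ⟨m, _, _, N, v, hc, hN, h⟩ := exists_commuting_projections hP S
  rw [← h S subset_rfl]
  exact vectorState_nonneg v (isStarProjection_noncommProd hN hc S)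

open Classical in
theorem sieve_finsetPfaffian_nonneg {P : Doubled 𝔛 →L[ℂ] Doubled 𝔛} (hP : P ∈ Gr 𝔛)
    -- The weight is the vacuum expectation of a product of commuting projections `N x` and `1 - N
    -- y`, itself a projection.
    {S A : Finset 𝔛} (hd : Disjoint S A) :
    0 ≤ sieve (fun S => (finsetPfaffian (kernel P) S).re) S A := by
  obtain ⟨m, _, _, N, v, hc, hN, h⟩ := exists_commuting_projections hP (S ∪ A)
  have hc' : ∀ x y, Commute (1 - N x) (1 - N y) := fun x y =>
    ((Commute.one_right _).sub_right ((Commute.one_left _).sub_left (hc x y)))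
  rw [← re_map_noncommProd_eq_sieve (φ := vectorState v) hc hc' (A := S ∪ A)
    (fun T hT => by rw [h T hT]) Finset.subset_union_left Finset.subset_union_right hd]
  refine (Complex.le_def.1 (vectorState_nonneg v ?_)).1
  refine (isStarProjection_noncommProd hN hc S).mul
    (isStarProjection_noncommProd (fun x => (hN x).one_sub) hc' A) ?_
  refine Finset.noncommProd_commute _ _ _ _ fun y _ => (Finset.noncommProd_commute _ _ _ _
    fun x _ => ?_).symm
  exact (Commute.one_left _).sub_left (hc y x)

theorem finsetPfaffian_empty (K : 𝔛 → 𝔛 → Matrix (Fin 2) (Fin 2) ℂ) :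
    finsetPfaffian K ∅ = 1 := by
  simp [finsetPfaffian, pfaffian]

theorem exists_isPfaffianProcess [Countable 𝔛] {P : Doubled 𝔛 →L[ℂ] Doubled 𝔛} (hP : P ∈ Gr 𝔛) :
    ∃ M, IsPfaffianProcess (kernel P) M := by
  classical
  obtain ⟨M, hM, h⟩ := exists_measure_of_sieve_nonneg
    (ρ := fun S => (finsetPfaffian (kernel P) S).re) (by simp [finsetPfaffian_empty])
    (fun S A hd => by convert sieve_finsetPfaffian_nonneg hP hd)
  refine ⟨M, hM, kernel_transpose hP.1, fun n x => ?_⟩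
  rw [correlation]
  split_ifs with hx
  · rw [cylinder_eq_finsetCylinder, h, pfaffian_kernelMatrix _ hx]
    exact Complex.ext rfl (Complex.le_def.1 (finsetPfaffian_nonneg hP _)).2
  · rw [pfaffian_kernelMatrix_of_not_injective _ hx]
    simp

theorem IsPfaffianProcess.eq [Countable 𝔛] {K : 𝔛 → 𝔛 → Matrix (Fin 2) (Fin 2) ℂ}
    {M M' : Measure (Config 𝔛)} (h : IsPfaffianProcess K M) (h' : IsPfaffianProcess K M') :
    M = M' := by
  classical
  have := h.isProbabilityMeasure
  have := h'.isProbabilityMeasure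
  refine ext_of_finsetCylinder fun S => ?_
  let x : Fin S.card → 𝔛 := fun i => S.equivFin.symm i
  have hx : Function.Injective x := fun i j h => S.equivFin.symm.injective (Subtype.ext h)
  have hxS : Finset.univ.image x = S := by
    ext y
    simp only [Finset.mem_image, Finset.mem_univ, true_and]
    exact ⟨by rintro ⟨i, rfl⟩; exact (S.equivFin.symm i).2,
      fun hy => ⟨S.equivFin ⟨y, hy⟩, by simp [x]⟩⟩
  have h1 := (h.correlation_eq _ x).trans (h'.correlation_eq _ x).symm
  rw [correlation, correlation, if_pos hx, if_pos hx, cylinder_eq_finsetCylinder, hxS] at h1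
  exact (measureReal_eq_measureReal_iff).1 (by exact_mod_cast h1)

end PfaffianMeasure

/-! ### Hilbert–Schmidt perturbations and Borel–Cantelli. -/

section Support

theorem pfaffian_of_unique {ι : Type*} [Fintype ι] [DecidableEq ι] [Unique ι]
    {A : Matrix (ι × Fin 2) (ι × Fin 2) ℂ} (hA : A.transpose = -A) :
    pfaffian A = A (default, 0) (default, 1) := by
  rw [← pfaffian_submatrix A (Equiv.ofUnique (Fin 1) ι)]
  have h : (Finset.univ : Finset (Equiv.Perm (Fin 1 × Fin 2))) =
      {1, Equiv.swap (0, 0) (0, 1)} := by decide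
  have h1 : A (default, 1) (default, 0) = - A (default, 0) (default, 1) :=
    congrFun (congrFun hA _) _
  rw [pfaffian, h, Finset.sum_pair (by decide)]
  simp [Prod.map, Subsingleton.elim _ (default : ι), h1]
  ring

/-- Parseval in `b`, exchange of sums, self-adjointness, then Bessel for `f`. This passes from the
unspecified basis of `IsHilbertSchmidt` to the vectors `(0, e_x)`. -/
theorem summable_norm_sq_of_orthonormal {H ι κ : Type*} [NormedAddCommGroup H]
    [InnerProductSpace ℂ H] [CompleteSpace H] {T : H →L[ℂ] H} (hT : IsSelfAdjoint T)
    (b : HilbertBasis ι ℂ H) (hb : Summable fun i => ‖T (b i)‖ ^ 2) {f : κ → H}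
    (hf : Orthonormal ℂ f) : Summable fun k => ‖T (f k)‖ ^ 2 := by
  have hsym := ContinuousLinearMap.isSelfAdjoint_iff_isSymmetric.1 hT
  have hp : ∀ u : H, HasSum (fun i => ‖inner ℂ (b i) u‖ ^ 2) (‖u‖ ^ 2) := fun u => by
    have := b.hasSum_inner_mul_inner u u
    rw [inner_self_eq_norm_sq_to_K] at this
    have h : ∀ i, inner ℂ u (b i) * inner ℂ (b i) u = ((‖inner ℂ (b i) u‖ ^ 2 : ℝ) : ℂ) :=
      fun i => by
        rw [← inner_conj_symm u, RCLike.conj_mul]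
        simp
    simp only [h] at this
    exact Complex.hasSum_ofReal.1 (by simpa using this)
  refine summable_of_sum_le (fun _ => by positivity) (c := ∑' i, ‖T (b i)‖ ^ 2) fun s => ?_
  calc ∑ k ∈ s, ‖T (f k)‖ ^ 2 = ∑ k ∈ s, ∑' i, ‖inner ℂ (b i) (T (f k))‖ ^ 2 :=
        Finset.sum_congr rfl fun k _ => (hp _).tsum_eq.symm
    _ = ∑' i, ∑ k ∈ s, ‖inner ℂ (b i) (T (f k))‖ ^ 2 :=
        (Summable.tsum_finsetSum fun k _ => (hp _).summable).symm
    _ ≤ ∑' i, ‖T (b i)‖ ^ 2 := by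
        refine Summable.tsum_le_tsum (fun i => ?_) (summable_sum fun k _ => (hp _).summable) hb
        calc ∑ k ∈ s, ‖inner ℂ (b i) (T (f k))‖ ^ 2 = ∑ k ∈ s, ‖inner ℂ (f k) (T (b i))‖ ^ 2 :=
              Finset.sum_congr rfl fun k _ => by
                rw [← hsym.apply_clm, ← inner_conj_symm, RCLike.norm_conj]
          _ ≤ ‖T (b i)‖ ^ 2 := hf.sum_inner_products_le _

variable {𝔛 : Type*}

theorem orthonormal_basisVec : Orthonormal ℂ (basisVec (𝔛 := 𝔛)) := by
  classical
  exact orthonormal_iff_ite.2 inner_basisVec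

theorem Pfin_apply_of_mem {X : Set 𝔛} {x : 𝔛} (hx : x ∈ X) :
    Pfin X (basisVec (x, 1)) = basisVec (x, 1) := by
  refine Submodule.starProjection_eq_self_iff.2 (Submodule.le_topologicalClosure _
    (Submodule.mem_sup_right (Submodule.le_topologicalClosure _ (Submodule.subset_span ?_))))
  exact ⟨x, hx, by simp [basisVec]⟩

theorem Pfin_apply_of_notMem {X : Set 𝔛} {x : 𝔛} (hx : x ∉ X) :
    Pfin X (basisVec (x, 1)) = 0 := by
  refine (Submodule.starProjection_apply_eq_zero_iff _).2 ?_
  rw [Submodule.orthogonal_closure, ← Submodule.inf_orthogonal, Kplus, Kminus,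
    Submodule.orthogonal_closure, Submodule.orthogonal_closure]
  have key : ∀ p, p ≠ (x, 1) → inner ℂ (basisVec p) (basisVec (x, (1 : Fin 2))) = (0 : ℂ) :=
    fun p hp => orthonormal_basisVec.2 hp
  constructor <;> rw [SetLike.mem_coe, Submodule.mem_orthogonal] <;> intro u hu <;>
    refine Submodule.span_induction ?_ (by simp) (fun _ _ _ _ h1 h2 => by
      rw [inner_add_left, h1, h2, add_zero]) (fun _ _ _ h => by rw [inner_smul_left, h, mul_zero]) hu
  · rintro _ ⟨y, hy, rfl⟩
    simpa [basisVec] using key (y, 0) (by simp)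
  · rintro _ ⟨y, hy, rfl⟩
    simpa [basisVec] using key (y, 1) (by rintro h; simp at h; exact hx (h ▸ hy))

theorem IsPfaffianProcess.measureReal_occupied {P : Doubled 𝔛 →L[ℂ] Doubled 𝔛} (hP : P ∈ Gr 𝔛)
    {M : Measure (Config 𝔛)} (hM : IsPfaffianProcess (kernel P) M) (x : 𝔛) :
    M.real {ω | ω x = true} = ‖P (basisVec (x, 1))‖ ^ 2 := by
  have h := hM.correlation_eq 1 fun _ => x
  rw [pfaffian_of_unique (kernelMatrix_transpose hM.antisymm _), correlation,
    if_pos (Function.injective_of_subsingleton _)] at h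
  have h1 : cylinder (fun _ : Fin 1 => x) = {ω | ω x = true} := by ext; simp [cylinder]
  have h2 : twoPoint P (x, 0) (x, 1) = ((‖P (basisVec (x, 1))‖ ^ 2 : ℝ) : ℂ) := by
    have hsym := ContinuousLinearMap.isSelfAdjoint_iff_isSymmetric.1 hP.1.isSelfAdjoint
    have := inner_self_eq_norm_sq_to_K (𝕜 := ℂ) (P (basisVec (x, 1)))
    rw [hsym.apply_clm, ← mul_apply_eq_comp, hP.2] at this
    simpa [twoPoint, bar] using this
  rw [h1] at h
  simp only [kernelMatrix, Matrix.of_apply, kernel_eq_twoPoint, h2] at h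
  simpa using Complex.ofReal_injective (h.trans (by simp))

theorem norm_sub_sq_of_mem_Gr {P : Doubled 𝔛 →L[ℂ] Doubled 𝔛} (hP : P ∈ Gr 𝔛) (u : Doubled 𝔛) :
    ‖P u - u‖ ^ 2 = ‖u‖ ^ 2 - ‖P u‖ ^ 2 := by
  have hsym := ContinuousLinearMap.isSelfAdjoint_iff_isSymmetric.1 hP.1.isSelfAdjoint
  have h1 : inner ℂ (P u) u = inner ℂ (P u) (P u) := by
    rw [hsym.apply_clm, hsym.apply_clm u, ← mul_apply_eq_comp, hP.2]
  rw [@norm_sub_sq ℂ, h1, inner_self_eq_norm_sq]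
  ring

theorem IsPfaffianProcess.measure_compl_omegaFin [Countable 𝔛] {X : Set 𝔛}
    {P : Doubled 𝔛 →L[ℂ] Doubled 𝔛} (hP : P ∈ Gr 𝔛) (hHS : IsHilbertSchmidt (P - Pfin X))
    {M : Measure (Config 𝔛)} (hM : IsPfaffianProcess (kernel P) M) : M (OmegaFin X)ᶜ = 0 := by
  classical
  have := hM.isProbabilityMeasure
  obtain ⟨w, b, hb⟩ := hHS
  have hQ : IsSelfAdjoint (Pfin X) := isSelfAdjoint_starProjection _
  have hsa : IsSelfAdjoint (P - Pfin X) := by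
    rw [ContinuousLinearMap.isSelfAdjoint_iff_isSymmetric] at hQ ⊢
    exact (ContinuousLinearMap.isSelfAdjoint_iff_isSymmetric.1 hP.1.isSelfAdjoint).sub hQ
  have hsum := summable_norm_sq_of_orthonormal hsa b hb
    (orthonormal_basisVec.comp (fun x : 𝔛 => (x, (1 : Fin 2))) fun x y h => congrArg Prod.fst h)
  -- The event that `ω` and `X` disagree at `x`.
  let s : 𝔛 → Set (Config 𝔛) := fun x => {ω | ω x = decide (x ∉ X)}
  have hmeas : ∀ x, MeasurableSet {ω : Config 𝔛 | ω x = true} := fun x =>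
    measurableSet_eq_fun (measurable_pi_apply x) measurable_const
  have hs : ∀ x, M.real (s x) = ‖(P - Pfin X) (basisVec (x, 1))‖ ^ 2 := by
    intro x
    by_cases hx : x ∈ X
    · have : s x = {ω | ω x = true}ᶜ := by ext; simp [s, hx]
      rw [this, measureReal_compl (hmeas x), hM.measureReal_occupied hP, sub_apply,
        Pfin_apply_of_mem hx, norm_sub_sq_of_mem_Gr hP, orthonormal_basisVec.1]
      simp
    · have : s x = {ω | ω x = true} := by ext; simp [s, hx]
      rw [this, hM.measureReal_occupied hP, sub_apply, Pfin_apply_of_notMem hx, sub_zero]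
  have hfin : ∑' x, M (s x) ≠ ⊤ := by
    have : ∀ x, M (s x) = ENNReal.ofReal (‖(P - Pfin X) (basisVec (x, 1))‖ ^ 2) := fun x => by
      rw [← hs, ofReal_measureReal]
    simp only [this]
    exact hsum.tsum_ofReal_ne_top
  change ∀ᵐ ω ∂M, ω ∈ OmegaFin X
  -- First Borel–Cantelli lemma; no independence is needed.
  filter_upwards [ae_finite_setOfPred_mem hfin] with ω hω
  refine ⟨hω.subset ?_, hω.subset ?_⟩
  · rintro x ⟨h1, h2⟩
    simpa [s, h2, occupied] using h1
  · rintro x ⟨h1, h2⟩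
    simpa [s, h1, occupied] using h2

end Support

end PfPP

theorem mainTheorem7 {𝔛 : Type*} [Countable 𝔛] (X : Set 𝔛)
    (P : PfPP.Doubled 𝔛 →L[ℂ] PfPP.Doubled 𝔛) (hP : P ∈ PfPP.Gr 𝔛)
    (hHS : PfPP.IsHilbertSchmidt (P - PfPP.Pfin X)) :
    (∃! M : MeasureTheory.Measure (PfPP.Config 𝔛),
      PfPP.IsPfaffianProcess (PfPP.kernel P) M) ∧
    ∀ M : MeasureTheory.Measure (PfPP.Config 𝔛),
      PfPP.IsPfaffianProcess (PfPP.kernel P) M → M (PfPP.OmegaFin X)ᶜ = 0 := by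
  obtain ⟨M, hM⟩ := PfPP.exists_isPfaffianProcess hP
  exact ⟨⟨M, hM, fun M' hM' => hM'.eq hM⟩, fun M hM => hM.measure_compl_omegaFin hP hHS⟩
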